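/- Let $A$ be an associative ring with unit (for instance an algebra over a commutative ring $K$) and let $\mathfrak C$ be an $A$-coring, that is, an $A$-bimodule with $A$-bimodule maps $\Delta:\mathfrak C\to\mathfrak C\otimes_A\mathfrak C$ and $\epsilon:\mathfrak C\to A$ which are coassociative and counital. A right $\mathfrak C$-comodule is a right $A$-module $M$ with a right $A$-linear, coassociative and counital map $\rho_M:M\to M\otimes_A\mathfrak C$; morphisms of comodules are the right $A$-linear maps that commute with the coactions. Assume that the category $\mathcal M^{\mathfrak C}$ of right $\mathfrak C$-comodules is abelian, and let $\mathcal A=(P_i)_{i\in I}$ be a generating (small) family of right $\mathfrak C$-comodules (if $f,g:X\to Y$ are morphisms of comodules such that $f h=g h$ for every $i\in I$ and every morphism $h:P_i\to X$, then $f=g$) such that every $P_i$ is finitely generated and projective as a right $A$-module. Let $\Sigma=\bigoplus_{i\in I}P_i$ be the coproduct in $\mathcal M^{\mathfrak C}$ (the direct sum of $A$-modules with the induced coaction $\rho_\Sigma$), with canonical injections $\iota_i$ and projections $\pi_i$, let $T=\mathrm{End}_{\mathfrak C}(\Sigma)$ be the ring of comodule endomorphisms of $\Sigma$, and let $\Sigma^*=\mathrm{Hom}_A(\Sigma,A)$,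 regarded as an $A$-$T$-bimodule by $(a\varphi t)(u)=a\,\varphi(t(u))$. The $A$-bimodule $\Sigma^*\otimes_T\Sigma$ is an $A$-coring (the infinite comatrix coring) with counit $\varphi\otimes_T u\mapsto\varphi(u)$ and comultiplication $$\Delta(\varphi\otimes_T\iota_i(p))=\sum_{\alpha}\bigl(\varphi\otimes_T\iota_i(e_\alpha)\bigr)\otimes_A\bigl(e_\alpha^*\pi_i\otimes_T\iota_i(p)\bigr)\qquad(\varphi\in\Sigma^*,\ i\in I,\ p\in P_i),$$ where $\{e_\alpha^*,e_\alpha\}$ is a finite dual basis of the right $A$-module $P_i$. Then the canonical map $$\mathsf{can}:\Sigma^*\otimes_T\Sigma\longrightarrow\mathfrak C,\qquad \mathsf{can}(\varphi\otimes_T u)=(\varphi\otimes_A\mathfrak C)(\rho_\Sigma(u))$$ (with $A\otimes_A\mathfrak C$ identified with $\mathfrak C$) is an isomorphism of $A$-corings. -/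

import Mathlib

open MulOpposite
open scoped TensorProduct DirectSum

universe u

namespace NCoring

/-! Right modules over a ring `R` are modules over `Rᵐᵒᵖ`; the product `m r` is `op r • m`.
An `S`-`R`-bimodule is a left `S`-module and right `R`-module `M` with `SMulCommClass S Rᵐᵒᵖ M`. -/

section Tensor

/-- The subgroup of `M ⊗[ℤ] N` generated by the elements `m r ⊗ n - m ⊗ r n`. -/
def balancedRel (R M N : Type*) [Ring R] [AddCommGroup M] [AddCommGroup N]
    [Module Rᵐᵒᵖ M] [Module R N] : AddSubgroup (M ⊗[ℤ] N) :=
  AddSubgroup.closure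
    {x | ∃ (m : M) (r : R) (n : N), x = (op r • m) ⊗ₜ[ℤ] n - m ⊗ₜ[ℤ] (r • n)}

/-- The tensor product `M ⊗_R N` of a right module and a left module over a ring `R` that need not
be commutative. -/
def BTensor (R M N : Type*) [Ring R] [AddCommGroup M] [AddCommGroup N]
    [Module Rᵐᵒᵖ M] [Module R N] : Type _ :=
  (M ⊗[ℤ] N) ⧸ balancedRel R M N

namespace BTensor

variable {R : Type*} [Ring R] {M N M' N' M'' N'' : Type*}
  [AddCommGroup M] [AddCommGroup N] [AddCommGroup M'] [AddCommGroup N']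
  [AddCommGroup M''] [AddCommGroup N'']
  [Module Rᵐᵒᵖ M] [Module R N] [Module Rᵐᵒᵖ M'] [Module R N']
  [Module Rᵐᵒᵖ M''] [Module R N'']

instance : AddCommGroup (BTensor R M N) :=
  inferInstanceAs (AddCommGroup ((M ⊗[ℤ] N) ⧸ balancedRel R M N))

variable (R) in
/-- The pure tensor `m ⊗_R n`. -/
def tmul (m : M) (n : N) : BTensor R M N :=
  QuotientAddGroup.mk' (balancedRel R M N) (m ⊗ₜ[ℤ] n)

theorem add_tmul (m m' : M) (n : N) : tmul R (m + m') n = tmul R m n + tmul R m' n := by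
  rw [tmul, TensorProduct.add_tmul, map_add]; rfl

theorem tmul_add (m : M) (n n' : N) : tmul R m (n + n') = tmul R m n + tmul R m n' := by
  rw [tmul, TensorProduct.tmul_add, map_add]; rfl

theorem smul_tmul (m : M) (r : R) (n : N) : tmul R (op r • m) n = tmul R m (r • n) := by
  have h : (op r • m) ⊗ₜ[ℤ] n - m ⊗ₜ[ℤ] (r • n) ∈ balancedRel R M N :=
    AddSubgroup.subset_closure ⟨m, r, n, rfl⟩
  have h2 := (QuotientAddGroup.eq_zero_iff _).2 h
  exact sub_eq_zero.1 h2

variable (R) in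
/-- `tmul` as a biadditive map. -/
def mk (M N : Type*) [AddCommGroup M] [AddCommGroup N] [Module Rᵐᵒᵖ M] [Module R N] :
    M →+ N →+ BTensor R M N :=
  AddMonoidHom.mk' (fun m => AddMonoidHom.mk' (fun n => tmul R m n) (tmul_add m))
    (fun m m' => by ext n; exact add_tmul m m' n)

@[simp] theorem mk_apply (m : M) (n : N) : mk R M N m n = tmul R m n := rfl

@[simp] theorem zero_tmul (n : N) : tmul R (0 : M) n = 0 :=
  congrFun (congrArg DFunLike.coe (map_zero (mk R M N))) n

@[simp] theorem tmul_zero (m : M) : tmul R m (0 : N) = 0 := map_zero (mk R M N m)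

@[simp] theorem neg_tmul (m : M) (n : N) : tmul R (-m) n = -tmul R m n :=
  congrFun (congrArg DFunLike.coe (map_neg (mk R M N) m)) n

theorem sum_tmul {κ : Type*} (s : Finset κ) (f : κ → M) (n : N) :
    tmul R (∑ k ∈ s, f k) n = ∑ k ∈ s, tmul R (f k) n :=
  map_sum ((mk R M N).flip n) f s

theorem tmul_sum {κ : Type*} (s : Finset κ) (m : M) (f : κ → N) :
    tmul R m (∑ k ∈ s, f k) = ∑ k ∈ s, tmul R m (f k) :=
  map_sum (mk R M N m) f s

@[elab_as_elim]
theorem induction {p : BTensor R M N → Prop} (x : BTensor R M N)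
    (h0 : p 0) (ht : ∀ m n, p (tmul R m n)) (ha : ∀ x y, p x → p y → p (x + y)) : p x := by
  obtain ⟨z, rfl⟩ := QuotientAddGroup.mk'_surjective (balancedRel R M N) x
  induction z with
  | zero => rw [map_zero]; exact h0
  | tmul m n => exact ht m n
  | add a b iha ihb => rw [map_add]; exact ha _ _ iha ihb

/-- The additive map out of `M ⊗_R N` given by an `R`-balanced biadditive map. -/
def lift {Q : Type*} [AddCommGroup Q] (f : M →+ N →+ Q)
    (hf : ∀ (m : M) (r : R) (n : N), f (op r • m) n = f m (r • n)) : BTensor R M N →+ Q :=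
  QuotientAddGroup.lift (balancedRel R M N)
    (TensorProduct.liftAddHom f (fun k m n => by simp)) (by
      rw [balancedRel, AddSubgroup.closure_le]
      rintro x ⟨m, r, n, rfl⟩
      simp [hf])

@[simp] theorem lift_tmul {Q : Type*} [AddCommGroup Q] (f : M →+ N →+ Q)
    (hf : ∀ (m : M) (r : R) (n : N), f (op r • m) n = f m (r • n)) (m : M) (n : N) :
    lift f hf (tmul R m n) = f m n := rfl

theorem hom_ext {Q : Type*} [AddCommGroup Q] {f g : BTensor R M N →+ Q}
    (h : ∀ m n, f (tmul R m n) = g (tmul R m n)) : f = g := by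
  ext x
  induction x using BTensor.induction with
  | h0 => simp
  | ht m n => exact h m n
  | ha x y hx hy => simp [hx, hy]

/-- The map `f ⊗_R g`. -/
def map (f : M →ₗ[Rᵐᵒᵖ] M') (g : N →ₗ[R] N') : BTensor R M N →+ BTensor R M' N' :=
  lift (((mk R M' N').compl₂ g.toAddMonoidHom).comp f.toAddMonoidHom) (fun _ _ _ => by
    simp [smul_tmul])

@[simp] theorem map_tmul (f : M →ₗ[Rᵐᵒᵖ] M') (g : N →ₗ[R] N') (m : M) (n : N) :
    map f g (tmul R m n) = tmul R (f m) (g n) := rfl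

theorem map_map (f : M →ₗ[Rᵐᵒᵖ] M') (g : N →ₗ[R] N') (f' : M' →ₗ[Rᵐᵒᵖ] M'')
    (g' : N' →ₗ[R] N'') (x : BTensor R M N) :
    map f' g' (map f g x) = map (f' ∘ₗ f) (g' ∘ₗ g) x :=
  DFunLike.congr_fun (hom_ext (f := (map f' g').comp (map f g))
    (g := map (f' ∘ₗ f) (g' ∘ₗ g)) (fun _ _ => rfl)) x

theorem map_id_id (x : BTensor R M N) :
    map (LinearMap.id : M →ₗ[Rᵐᵒᵖ] M) (LinearMap.id : N →ₗ[R] N) x = x :=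
  DFunLike.congr_fun (hom_ext (f := map LinearMap.id LinearMap.id) (g := AddMonoidHom.id _)
    (fun _ _ => rfl)) x

theorem map_add_left (f f' : M →ₗ[Rᵐᵒᵖ] M') (g : N →ₗ[R] N') (x : BTensor R M N) :
    map (f + f') g x = map f g x + map f' g x :=
  DFunLike.congr_fun (hom_ext (f := map (f + f') g) (g := map f g + map f' g)
    (fun m n => add_tmul (f m) (f' m) (g n))) x

theorem map_zero_left (g : N →ₗ[R] N') (x : BTensor R M N) :
    map (0 : M →ₗ[Rᵐᵒᵖ] M') g x = 0 :=
  DFunLike.congr_fun (hom_ext (f := map (0 : M →ₗ[Rᵐᵒᵖ] M') g) (g := 0)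
    (fun m n => zero_tmul (g n))) x

theorem map_neg_left (f : M →ₗ[Rᵐᵒᵖ] M') (g : N →ₗ[R] N') (x : BTensor R M N) :
    map (-f) g x = -map f g x :=
  DFunLike.congr_fun (hom_ext (f := map (-f) g) (g := -map f g)
    (fun m n => neg_tmul (f m) (g n))) x

section Left

variable {S : Type*} [Ring S] [Module S M] [SMulCommClass S Rᵐᵒᵖ M]

/-- If `M` is an `S`-`R`-bimodule, then `M ⊗_R N` is a left `S`-module. -/
instance leftModule : Module S (BTensor R M N) where
  smul s := map (DistribSMul.toLinearMap Rᵐᵒᵖ M s) LinearMap.id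
  one_smul x := by
    induction x using BTensor.induction with
    | h0 => exact map_zero _
    | ht m n => exact congrArg (fun m => tmul R m n) (one_smul S m)
    | ha x y hx hy => exact (map_add _ x y).trans (congrArg₂ _ hx hy)
  mul_smul s t x := by
    induction x using BTensor.induction with
    | h0 => exact (map_zero _).trans ((congrArg _ (map_zero _)).trans (map_zero _)).symm
    | ht m n => exact congrArg (fun m => tmul R m n) (mul_smul s t m)
    | ha x y hx hy =>
      exact (map_add _ x y).trans ((congrArg₂ _ hx hy).trans
        (((congrArg _ (map_add _ x y))).trans (map_add _ _ _)).symm)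
  smul_zero s := map_zero _
  smul_add s x y := map_add _ x y
  add_smul s t x := by
    induction x using BTensor.induction with
    | h0 => exact (map_zero _).trans ((congrArg₂ _ (map_zero _) (map_zero _)).trans
        (add_zero _)).symm
    | ht m n =>
      exact (congrArg (fun m => tmul R m n) (add_smul s t m)).trans (add_tmul _ _ _)
    | ha x y hx hy =>
      exact (map_add _ x y).trans ((congrArg₂ _ hx hy).trans ((add_add_add_comm _ _ _ _).trans
        (congrArg₂ _ (map_add _ x y).symm (map_add _ x y).symm)))
  zero_smul x := by
    induction x using BTensor.induction with
    | h0 => exact map_zero _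
    | ht m n =>
      exact (congrArg (fun m => tmul R m n) (zero_smul S m)).trans
        (congrFun (congrArg DFunLike.coe (map_zero (mk R M N))) n)
    | ha x y hx hy => exact (map_add _ x y).trans ((congrArg₂ _ hx hy).trans (add_zero _))

@[simp] theorem left_smul_tmul (s : S) (m : M) (n : N) :
    s • tmul R m n = tmul R (s • m) n := rfl

end Left

section Right

variable {S : Type*} [Ring S] [Module Sᵐᵒᵖ N] [SMulCommClass R Sᵐᵒᵖ N]

/-- If `N` is an `R`-`S`-bimodule, then `M ⊗_R N` is a right `S`-module. -/
instance rightModule : Module Sᵐᵒᵖ (BTensor R M N) where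
  smul s := map LinearMap.id
    (haveI : SMulCommClass Sᵐᵒᵖ R N := SMulCommClass.symm _ _ _
     DistribSMul.toLinearMap R N s)
  one_smul x := by
    induction x using BTensor.induction with
    | h0 => exact map_zero _
    | ht m n => exact congrArg (fun n => tmul R m n) (one_smul Sᵐᵒᵖ n)
    | ha x y hx hy => exact (map_add _ x y).trans (congrArg₂ _ hx hy)
  mul_smul s t x := by
    induction x using BTensor.induction with
    | h0 => exact (map_zero _).trans ((congrArg _ (map_zero _)).trans (map_zero _)).symm
    | ht m n => exact congrArg (fun n => tmul R m n) (mul_smul s t n)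
    | ha x y hx hy =>
      exact (map_add _ x y).trans ((congrArg₂ _ hx hy).trans
        (((congrArg _ (map_add _ x y))).trans (map_add _ _ _)).symm)
  smul_zero s := map_zero _
  smul_add s x y := map_add _ x y
  add_smul s t x := by
    induction x using BTensor.induction with
    | h0 => exact (map_zero _).trans ((congrArg₂ _ (map_zero _) (map_zero _)).trans
        (add_zero _)).symm
    | ht m n =>
      exact (congrArg (fun n => tmul R m n) (add_smul s t n)).trans (tmul_add _ _ _)
    | ha x y hx hy =>
      exact (map_add _ x y).trans ((congrArg₂ _ hx hy).trans ((add_add_add_comm _ _ _ _).trans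
        (congrArg₂ _ (map_add _ x y).symm (map_add _ x y).symm)))
  zero_smul x := by
    induction x using BTensor.induction with
    | h0 => exact map_zero _
    | ht m n =>
      exact (congrArg (fun n => tmul R m n) (zero_smul Sᵐᵒᵖ n)).trans (map_zero (mk R M N m))
    | ha x y hx hy => exact (map_add _ x y).trans ((congrArg₂ _ hx hy).trans (add_zero _))

@[simp] theorem right_smul_tmul (s : Sᵐᵒᵖ) (m : M) (n : N) :
    s • tmul R m n = tmul R m (s • n) := rfl

end Right

instance {S S' : Type*} [Ring S] [Ring S'] [Module S M] [SMulCommClass S Rᵐᵒᵖ M]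
    [Module S'ᵐᵒᵖ N] [SMulCommClass R S'ᵐᵒᵖ N] : SMulCommClass S S'ᵐᵒᵖ (BTensor R M N) where
  smul_comm s t x := by
    induction x using BTensor.induction with
    | h0 => simp
    | ht m n => simp
    | ha x y hx hy => simp [hx, hy]

section Assoc

variable {S : Type*} [Ring S] [Module Sᵐᵒᵖ N] [SMulCommClass R Sᵐᵒᵖ N]
  {Q : Type*} [AddCommGroup Q] [Module S Q]

variable (R M N S Q) in
/-- The biadditive map `(m ⊗ n, q) ↦ m ⊗ (n ⊗ q)`. -/
def assocAux : BTensor R M N →+ Q →+ BTensor R M (BTensor S N Q) :=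
  lift
    (AddMonoidHom.mk' (fun m => AddMonoidHom.mk'
      (fun n => (mk R M (BTensor S N Q) m).comp (mk S N Q n))
        (fun n n' => by ext q; exact (congrArg _ (add_tmul n n' q)).trans (tmul_add _ _ _)))
      (fun m m' => by ext n q; exact add_tmul _ _ _))
    (fun m r n => by ext q; exact smul_tmul m r (tmul S n q))

/-- The canonical map `(M ⊗_R N) ⊗_S Q → M ⊗_R (N ⊗_S Q)`. -/
def assoc : BTensor S (BTensor R M N) Q →+ BTensor R M (BTensor S N Q) :=
  lift (assocAux R M N S Q) (fun x s q => by
    induction x using BTensor.induction with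
    | h0 => rw [smul_zero, map_zero]; rfl
    | ht m n => exact congrArg (tmul R m) (smul_tmul n s q)
    | ha x y hx hy =>
      rw [smul_add, map_add, map_add, AddMonoidHom.add_apply, AddMonoidHom.add_apply, hx, hy])

@[simp] theorem assoc_tmul (m : M) (n : N) (q : Q) :
    assoc (tmul S (tmul R m n) q) = tmul R m (tmul S n q) := rfl

end Assoc

variable (R N) in
/-- The canonical map `R ⊗_R N → N`, `r ⊗ n ↦ r n`. -/
def lid : BTensor R R N →+ N :=
  lift (AddMonoidHom.mk' (fun r => DistribSMul.toAddMonoidHom N r)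
    (fun r r' => by ext n; simp [add_smul])) (fun r r' n => by simp [mul_smul])

@[simp] theorem lid_tmul (r : R) (n : N) : lid R N (tmul R r n) = r • n := rfl

variable (R M) in
/-- The canonical map `M ⊗_R R → M`, `m ⊗ r ↦ m r`. -/
def rid : BTensor R M R →+ M :=
  lift (AddMonoidHom.mk' (fun m => AddMonoidHom.mk' (fun r : R => op r • m)
      (fun r r' => by simp [add_smul]))
    (fun m m' => by ext r; simp)) (fun _ _ _ => by simp [mul_smul])

@[simp] theorem rid_tmul (m : M) (r : R) : rid R M (tmul R m r) = op r • m := rfl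

end BTensor

end Tensor

section Bimodules

/-- Homomorphisms of `A`-bimodules. -/
structure BimodHom (A M N : Type*) [Ring A] [AddCommGroup M] [AddCommGroup N]
    [Module A M] [Module Aᵐᵒᵖ M] [Module A N] [Module Aᵐᵒᵖ N] extends M →+ N where
  map_left (a : A) (m : M) : toFun (a • m) = a • toFun m
  map_right (a : A) (m : M) : toFun (op a • m) = op a • toFun m

namespace BimodHom

variable {A M N : Type*} [Ring A] [AddCommGroup M] [AddCommGroup N]
  [Module A M] [Module Aᵐᵒᵖ M] [Module A N] [Module Aᵐᵒᵖ N]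

instance : CoeFun (BimodHom A M N) (fun _ => M → N) := ⟨fun f => f.toAddMonoidHom⟩

/-- The underlying homomorphism of left modules. -/
def left (f : BimodHom A M N) : M →ₗ[A] N where
  toFun := f
  map_add' := map_add f.toAddMonoidHom
  map_smul' := f.map_left

/-- The underlying homomorphism of right modules. -/
def right (f : BimodHom A M N) : M →ₗ[Aᵐᵒᵖ] N where
  toFun := f
  map_add' := map_add f.toAddMonoidHom
  map_smul' a := f.map_right a.unop

@[simp] theorem left_apply (f : BimodHom A M N) (m : M) : f.left m = f m := rfl

@[simp] theorem right_apply (f : BimodHom A M N) (m : M) : f.right m = f m := rfl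

end BimodHom

end Bimodules

section Corings

open BTensor

/-- The structure of an `A`-coring on an `A`-bimodule `C`. -/
class Coring (A : Type*) [Ring A] (C : Type*) [AddCommGroup C] [Module A C] [Module Aᵐᵒᵖ C]
    [SMulCommClass A Aᵐᵒᵖ C] where
  /-- The comultiplication. -/
  comul : BimodHom A C (BTensor A C C)
  /-- The counit. -/
  counit : BimodHom A C A
  coassoc (c : C) : assoc (map comul.right LinearMap.id (comul c)) =
    map LinearMap.id comul.left (comul c)
  counit_left (c : C) : lid A C (map counit.right LinearMap.id (comul c)) = c
  counit_right (c : C) : rid A C (map LinearMap.id counit.left (comul c)) = c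

variable {A : Type*} [Ring A] {C D : Type*}
  [AddCommGroup C] [Module A C] [Module Aᵐᵒᵖ C] [SMulCommClass A Aᵐᵒᵖ C] [Coring A C]
  [AddCommGroup D] [Module A D] [Module Aᵐᵒᵖ D] [SMulCommClass A Aᵐᵒᵖ D] [Coring A D]

/-- A homomorphism of `A`-corings is an `A`-bimodule map that is compatible with comultiplications
and counits. -/
structure IsCoringHom (f : BimodHom A C D) : Prop where
  map_comul (c : C) : Coring.comul (A := A) (f c) = map f.right f.left (Coring.comul (A := A) c)
  map_counit (c : C) : Coring.counit (A := A) (f c) = Coring.counit (A := A) c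

/-- An isomorphism of `A`-corings is a homomorphism of `A`-corings with a two-sided inverse
that is a homomorphism of `A`-corings. -/
def IsCoringIso (f : BimodHom A C D) : Prop :=
  IsCoringHom f ∧ ∃ g : BimodHom A D C, IsCoringHom g ∧ (∀ c, g (f c) = c) ∧ ∀ d, f (g d) = d

end Corings

section Comodules

open BTensor

/-- A right comodule over the `A`-coring `C`. -/
structure RightComod (A : Type u) [Ring A] (C : Type u) [AddCommGroup C] [Module A C]
    [Module Aᵐᵒᵖ C] [SMulCommClass A Aᵐᵒᵖ C] [Coring A C] where
  /-- The underlying right `A`-module. -/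
  carrier : Type u
  [addCommGroup : AddCommGroup carrier]
  [module : Module Aᵐᵒᵖ carrier]
  /-- The coaction. -/
  coact : carrier →ₗ[Aᵐᵒᵖ] BTensor A carrier C
  coassoc (m : carrier) : assoc (map coact LinearMap.id (coact m)) =
    map LinearMap.id (Coring.comul (A := A) (C := C)).left (coact m)
  counit (m : carrier) :
    rid A carrier (map LinearMap.id (Coring.counit (A := A) (C := C)).left (coact m)) = m

namespace RightComod

variable {A : Type u} [Ring A] {C : Type u} [AddCommGroup C] [Module A C]
    [Module Aᵐᵒᵖ C] [SMulCommClass A Aᵐᵒᵖ C] [Coring A C]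

instance : CoeSort (RightComod A C) (Type u) := ⟨RightComod.carrier⟩

attribute [instance] RightComod.addCommGroup RightComod.module

/-- A right `A`-linear map is colinear if it commutes with the coactions. -/
def IsColinear {M N : RightComod A C} (f : M →ₗ[Aᵐᵒᵖ] N) : Prop :=
  ∀ m : M, map f LinearMap.id (M.coact m) = N.coact (f m)

/-- Morphisms of right comodules. -/
@[ext]
structure Hom (M N : RightComod A C) where
  /-- The underlying right `A`-linear map. -/
  toLinearMap : M →ₗ[Aᵐᵒᵖ] N
  colinear : IsColinear toLinearMap

theorem isColinear_id (M : RightComod A C) : IsColinear (LinearMap.id : M →ₗ[Aᵐᵒᵖ] M) :=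
  fun _ => map_id_id _

theorem IsColinear.comp {M N Q : RightComod A C} {g : N →ₗ[Aᵐᵒᵖ] Q} {f : M →ₗ[Aᵐᵒᵖ] N}
    (hg : IsColinear g) (hf : IsColinear f) : IsColinear (g ∘ₗ f) := fun m => by
  have h := map_map f (LinearMap.id : C →ₗ[A] C) g LinearMap.id (M.coact m)
  rw [LinearMap.id_comp] at h
  rw [← h, hf m, hg (f m)]
  rfl

/-- The category of right `C`-comodules. -/
instance : CategoryTheory.Category.{u} (RightComod A C) where
  Hom := Hom
  id M := ⟨LinearMap.id, isColinear_id M⟩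
  comp f g := ⟨g.toLinearMap ∘ₗ f.toLinearMap, g.colinear.comp f.colinear⟩

/-- The ring of endomorphisms of a right comodule, multiplication being composition
(`(s * t) m = s (t m)`). -/
def End (M : RightComod A C) : Subring (Module.End Aᵐᵒᵖ M) where
  carrier := {f | IsColinear f}
  mul_mem' hf hg := hf.comp hg
  one_mem' := isColinear_id M
  add_mem' {f g} hf hg m := by
    rw [map_add_left, hf m, hg m, ← map_add]
    rfl
  zero_mem' m := (map_zero_left _ _).trans (map_zero M.coact).symm
  neg_mem' {f} hf m := by
    rw [map_neg_left, hf m, ← map_neg]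
    rfl

variable {ι : Type u} [DecidableEq ι] (P : ι → RightComod A C)

/-- The coaction `⨁ᵢ Pᵢ → (⨁ᵢ Pᵢ) ⊗_A C` induced by the coactions of the `Pᵢ`. -/
def sumCoact : (⨁ i, P i) →ₗ[Aᵐᵒᵖ] BTensor A (⨁ i, P i) C :=
  DirectSum.toModule Aᵐᵒᵖ ι _ (fun i =>
    { toFun := fun p =>
        map (DirectSum.lof Aᵐᵒᵖ ι (fun i => P i) i) LinearMap.id ((P i).coact p)
      map_add' := fun p q => by simp
      map_smul' := fun a p => by
        have h : ∀ x : BTensor A (P i) C,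
            map (DirectSum.lof Aᵐᵒᵖ ι (fun i => P i) i) LinearMap.id (a • x) =
            a • map (DirectSum.lof Aᵐᵒᵖ ι (fun i => P i) i) (LinearMap.id : C →ₗ[A] C) x := by
          intro x
          induction x using BTensor.induction with
          | h0 => simp
          | ht m n => rfl
          | ha x y hx hy => simp only [map_add, smul_add, hx, hy]
        simp [h] })

theorem sumCoact_lof (i : ι) (p : P i) :
    sumCoact P (DirectSum.lof Aᵐᵒᵖ ι (fun i => P i) i p) =
      map (DirectSum.lof Aᵐᵒᵖ ι (fun i => P i) i) LinearMap.id ((P i).coact p) := by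
  rw [sumCoact, DirectSum.toModule_lof]
  rfl

/-- The coproduct `⨁ᵢ Pᵢ` of a family of right comodules. -/
def sum : RightComod A C where
  carrier := ⨁ i, P i
  coact := sumCoact P
  coassoc m := by
    induction m using DirectSum.induction_on with
    | zero => simp
    | add x y hx hy => simp only [map_add, hx, hy]
    | of i p =>
      change assoc (map (sumCoact P) LinearMap.id (sumCoact P (DirectSum.lof Aᵐᵒᵖ ι _ i p))) =
        map LinearMap.id _ (sumCoact P (DirectSum.lof Aᵐᵒᵖ ι _ i p))
      rw [sumCoact_lof, map_map]
      have h : ∀ x : BTensor A (P i) C,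
          assoc (map (sumCoact P ∘ₗ DirectSum.lof Aᵐᵒᵖ ι (fun i => P i) i)
            (LinearMap.id ∘ₗ LinearMap.id) x) =
          map (DirectSum.lof Aᵐᵒᵖ ι (fun i => P i) i) LinearMap.id
            (assoc (map (P i).coact LinearMap.id x)) := by
        intro x
        induction x using BTensor.induction with
        | h0 => simp
        | ha x y hx hy => simp only [map_add, hx, hy]
        | ht m n =>
          simp only [map_tmul, LinearMap.comp_apply, sumCoact_lof, LinearMap.id_apply]
          generalize (P i).coact m = y
          induction y using BTensor.induction with
          | h0 => simp
          | ht m' n' => rfl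
          | ha x y hx hy => simp only [map_add, add_tmul, hx, hy]
      rw [h, (P i).coassoc, map_map, map_map]
      rfl
  counit m := by
    induction m using DirectSum.induction_on with
    | zero => simp
    | add x y hx hy => simp only [map_add, hx, hy]
    | of i p =>
      change rid A _ (map LinearMap.id _ (sumCoact P (DirectSum.lof Aᵐᵒᵖ ι _ i p))) =
        DirectSum.lof Aᵐᵒᵖ ι (fun i => P i) i p
      rw [sumCoact_lof, map_map]
      have h : ∀ x : BTensor A (P i) C,
          rid A (⨁ i, P i) (map (LinearMap.id ∘ₗ DirectSum.lof Aᵐᵒᵖ ι (fun i => P i) i)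
            ((Coring.counit (A := A) (C := C)).left ∘ₗ LinearMap.id) x) =
          DirectSum.lof Aᵐᵒᵖ ι (fun i => P i) i
            (rid A (P i) (map LinearMap.id (Coring.counit (A := A) (C := C)).left x)) := by
        intro x
        induction x using BTensor.induction with
        | h0 => simp
        | ha x y hx hy => simp only [map_add, hx, hy]
        | ht m n => simp
      rw [h, (P i).counit]

end RightComod

end Comodules

section Dual

/-- The dual `M^* = Hom_A(M, A)` of a right `A`-module. -/
def RDual (A M : Type*) [Ring A] [AddCommGroup M] [Module Aᵐᵒᵖ M] : Type _ := M →ₗ[Aᵐᵒᵖ] A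

namespace RDual

variable {A M : Type*} [Ring A] [AddCommGroup M] [Module Aᵐᵒᵖ M]

instance : AddCommGroup (RDual A M) := inferInstanceAs (AddCommGroup (M →ₗ[Aᵐᵒᵖ] A))

instance : FunLike (RDual A M) M A := inferInstanceAs (FunLike (M →ₗ[Aᵐᵒᵖ] A) M A)

instance : LinearMapClass (RDual A M) Aᵐᵒᵖ M A :=
  inferInstanceAs (LinearMapClass (M →ₗ[Aᵐᵒᵖ] A) Aᵐᵒᵖ M A)

/-- The left `A`-module structure `(a φ) m = a (φ m)`. -/
instance : Module A (RDual A M) := inferInstanceAs (Module A (M →ₗ[Aᵐᵒᵖ] A))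

theorem ext {φ ψ : RDual A M} (h : ∀ m, φ m = ψ m) : φ = ψ := DFunLike.ext _ _ h

@[simp] theorem add_apply (φ ψ : RDual A M) (m : M) : (φ + ψ) m = φ m + ψ m := rfl

@[simp] theorem smul_apply (a : A) (φ : RDual A M) (m : M) : (a • φ) m = a * φ m := rfl

theorem sum_apply {κ : Type*} (s : Finset κ) (f : κ → RDual A M) (m : M) :
    (∑ k ∈ s, f k) m = ∑ k ∈ s, f k m := LinearMap.sum_apply (σ₁₂ := RingHom.id Aᵐᵒᵖ) s f m

/-- Precomposition of a functional with a right linear map. -/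
def comp {N : Type*} [AddCommGroup N] [Module Aᵐᵒᵖ N] (φ : RDual A N) (f : M →ₗ[Aᵐᵒᵖ] N) :
    RDual A M := LinearMap.comp (σ₁₂ := RingHom.id Aᵐᵒᵖ) (σ₂₃ := RingHom.id Aᵐᵒᵖ) φ f

@[simp] theorem comp_apply {N : Type*} [AddCommGroup N] [Module Aᵐᵒᵖ N] (φ : RDual A N)
    (f : M →ₗ[Aᵐᵒᵖ] N) (m : M) : φ.comp f m = φ (f m) := rfl

/-- The underlying linear map. -/
def lin (φ : RDual A M) : M →ₗ[Aᵐᵒᵖ] A := φ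

@[simp] theorem lin_apply (φ : RDual A M) (m : M) : φ.lin m = φ m := rfl

variable {S : Type*} [Ring S] [Module S M] [SMulCommClass S Aᵐᵒᵖ M]

/-- If `M` is an `S`-`A`-bimodule, then `M^*` is a right `S`-module by `(φ s) m = φ (s m)`. -/
instance : Module Sᵐᵒᵖ (RDual A M) where
  smul s φ := φ.comp (DistribSMul.toLinearMap Aᵐᵒᵖ M s.unop)
  one_smul φ := ext fun m => congrArg φ (one_smul S m)
  mul_smul s t φ := ext fun m => congrArg φ (mul_smul t.unop s.unop m)
  smul_zero _ := rfl
  smul_add _ _ _ := rfl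
  add_smul s t φ := ext fun m =>
    (congrArg φ (add_smul s.unop t.unop m)).trans (map_add φ _ _)
  zero_smul φ := ext fun m => (congrArg φ (zero_smul S m)).trans (map_zero φ)

@[simp] theorem op_smul_apply (s : S) (φ : RDual A M) (m : M) : (op s • φ) m = φ (s • m) := rfl

instance : SMulCommClass A Sᵐᵒᵖ (RDual A M) where
  smul_comm _ _ _ := rfl

end RDual

/-- Dual basis theorem: a finitely generated projective right module has a finite dual basis. -/
theorem exists_dualBasis (A M : Type*) [Ring A] [AddCommGroup M] [Module Aᵐᵒᵖ M]
    [Module.Finite Aᵐᵒᵖ M] [Module.Projective Aᵐᵒᵖ M] :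
    ∃ (n : ℕ) (e : Fin n → M) (f : Fin n → RDual A M), ∀ m, ∑ k, op (f k m) • e k = m := by
  obtain ⟨n, p, s, -, -, h⟩ := Module.Finite.exists_comp_eq_id_of_projective Aᵐᵒᵖ M
  refine ⟨n, fun k => p (Pi.single k 1), fun k =>
    ({ toFun := fun m => (s m k).unop
       map_add' := fun x y => by simp
       map_smul' := fun a x => by simp } : M →ₗ[Aᵐᵒᵖ] A), fun m => ?_⟩
  have h2 : p (s m) = m := LinearMap.congr_fun h m
  conv_rhs => rw [← h2, ← Finset.univ_sum_single (s m), map_sum]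
  refine Finset.sum_congr rfl fun k _ => ?_
  change s m k • p (Pi.single k 1) = _
  rw [← map_smul, ← Pi.single_smul]
  simp

end Dual

section Comatrix

open BTensor RightComod

variable {A : Type u} [Ring A] {C : Type u} [AddCommGroup C] [Module A C]
    [Module Aᵐᵒᵖ C] [SMulCommClass A Aᵐᵒᵖ C] [Coring A C]

/-- The `A`-bimodule `M^* ⊗_T M` for a right comodule `M` with endomorphism ring `T`. -/
abbrev DualTensor (M : RightComod A C) : Type u := BTensor M.End (RDual A M) M

/-- Right linearity of `u ↦ φ ⊗ u`. -/
def tensorLeft {M : RightComod A C} (φ : RDual A M) : M →ₗ[Aᵐᵒᵖ] DualTensor M where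
  toFun u := tmul M.End φ u
  map_add' := tmul_add φ
  map_smul' _ _ := rfl

@[simp] theorem tensorLeft_apply {M : RightComod A C} (φ : RDual A M) (u : M) :
    tensorLeft φ u = tmul M.End φ u := rfl

/-- The evaluation `M^* ⊗_T M → A`, `φ ⊗ u ↦ φ u`. -/
def evalHom (M : RightComod A C) : BimodHom A (DualTensor M) A where
  toAddMonoidHom := lift
    (AddMonoidHom.mk' (fun φ : RDual A M => φ.lin.toAddMonoidHom) (fun _ _ => rfl))
    (fun _ _ _ => rfl)
  map_left a x := by
    change lift _ _ (a • x) = a • lift _ _ x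
    induction x using BTensor.induction with
    | h0 => simp
    | ht φ u => rfl
    | ha x y hx hy => simp only [smul_add, map_add, hx, hy]
  map_right a x := by
    change lift _ _ (op a • x) = op a • lift _ _ x
    induction x using BTensor.induction with
    | h0 => simp
    | ht φ u => exact map_smul φ (op a) u
    | ha x y hx hy => simp only [smul_add, map_add, hx, hy]

@[simp] theorem evalHom_tmul (M : RightComod A C) (φ : RDual A M) (u : M) :
    evalHom M (tmul M.End φ u) = φ u := rfl

/-- The canonical map `can : M^* ⊗_T M → C`, `can (φ ⊗ u) = (φ ⊗_A C) (ρ_M u)`, where `A ⊗_A C`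
is identified with `C`. -/
def can (M : RightComod A C) : BimodHom A (DualTensor M) C where
  toAddMonoidHom := lift
    (AddMonoidHom.mk' (fun φ : RDual A M =>
      (lid A C).comp ((map φ.lin LinearMap.id).comp M.coact.toAddMonoidHom))
      (fun φ ψ => by
        ext u
        change lid A C (map (φ.lin + ψ.lin) LinearMap.id (M.coact u)) = _
        rw [map_add_left, map_add]; rfl))
    (fun φ t u => by
      change lid A C (map (φ.lin ∘ₗ t.1) (LinearMap.id ∘ₗ LinearMap.id) (M.coact u)) =
        lid A C (map φ.lin LinearMap.id (M.coact (t.1 u)))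
      rw [← t.2 u, map_map])
  map_left a x := by
    change lift _ _ (a • x) = a • lift _ _ x
    induction x using BTensor.induction with
    | h0 => simp
    | ht φ u =>
      change lid A C (map (a • φ).lin LinearMap.id (M.coact u)) =
        a • lid A C (map φ.lin LinearMap.id (M.coact u))
      generalize M.coact u = y
      induction y using BTensor.induction with
      | h0 => simp
      | ht m c => simp [mul_smul]
      | ha x y hx hy => simp only [smul_add, map_add, hx, hy]
    | ha x y hx hy => simp only [smul_add, map_add, hx, hy]
  map_right a x := by
    change lift _ _ (op a • x) = op a • lift _ _ x
    induction x using BTensor.induction with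
    | h0 => simp
    | ht φ u =>
      change lid A C (map φ.lin LinearMap.id (M.coact (op a • u))) =
        op a • lid A C (map φ.lin LinearMap.id (M.coact u))
      rw [map_smul]
      generalize M.coact u = y
      induction y using BTensor.induction with
      | h0 => simp
      | ht m c => simp [smul_comm]
      | ha x y hx hy => simp only [smul_add, map_add, hx, hy]
    | ha x y hx hy => simp only [smul_add, map_add, hx, hy]

theorem can_tmul (M : RightComod A C) (φ : RDual A M) (u : M) :
    can M (tmul M.End φ u) = lid A C (map φ.lin LinearMap.id (M.coact u)) := rfl

variable {ι : Type u} [DecidableEq ι] (P : ι → RightComod A C)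

/-- The canonical injection `Pᵢ → ⨁ⱼ Pⱼ`. -/
def inj (i : ι) : P i →ₗ[Aᵐᵒᵖ] sum P := DirectSum.lof Aᵐᵒᵖ ι (fun i => P i) i

/-- The canonical projection `⨁ⱼ Pⱼ → Pᵢ`. -/
def proj (i : ι) : sum P →ₗ[Aᵐᵒᵖ] P i := DirectSum.component Aᵐᵒᵖ ι (fun i => P i) i

theorem proj_inj (i : ι) (p : P i) : proj P i (inj P i p) = p := by
  change DirectSum.component Aᵐᵒᵖ ι (fun i => P i) i
    (DirectSum.lof Aᵐᵒᵖ ι (fun i => P i) i p) = p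
  rw [DirectSum.component.lof_self]

theorem proj_inj_ne {i j : ι} (h : j ≠ i) (p : P j) : proj P i (inj P j p) = 0 := by
  change DirectSum.component Aᵐᵒᵖ ι (fun i => P i) i
    (DirectSum.lof Aᵐᵒᵖ ι (fun i => P i) j p) = 0
  rw [DirectSum.component.of, dif_neg h]

theorem coact_inj (i : ι) (p : P i) :
    (sum P).coact (inj P i p) = map (inj P i) LinearMap.id ((P i).coact p) :=
  sumCoact_lof P i p

@[elab_as_elim]
theorem sum_induction {q : sum P → Prop} (u : sum P) (h0 : q 0) (hi : ∀ i p, q (inj P i p))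
    (ha : ∀ x y, q x → q y → q (x + y)) : q u :=
  DirectSum.induction_on u h0 hi ha

theorem exists_finset (u : sum P) :
    ∃ F₀ : Finset ι, ∀ F, F₀ ⊆ F → ∑ j ∈ F, inj P j (proj P j u) = u := by
  induction u using sum_induction with
  | h0 => exact ⟨∅, fun F _ => by simp⟩
  | hi i p =>
    refine ⟨{i}, fun F hF => ?_⟩
    rw [Finset.sum_eq_single_of_mem i (hF (Finset.mem_singleton_self i)), proj_inj]
    intro j _ hj
    rw [proj_inj_ne P hj.symm, map_zero]
  | ha x y hx hy =>
    obtain ⟨F₁, h₁⟩ := hx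
    obtain ⟨F₂, h₂⟩ := hy
    refine ⟨F₁ ∪ F₂, fun F hF => ?_⟩
    simp only [map_add, Finset.sum_add_distrib]
    rw [h₁ F (Finset.union_subset_left hF), h₂ F (Finset.union_subset_right hF)]

/-- The idempotent `ιᵢ πᵢ` of the endomorphism ring `T` of `⨁ⱼ Pⱼ`. -/
def idem (i : ι) : (sum P).End :=
  ⟨inj P i ∘ₗ proj P i, fun u => by
    induction u using sum_induction with
    | h0 => simp
    | ha x y hx hy => simp only [map_add, hx, hy]
    | hi j p =>
      have h := map_map (inj P j) (LinearMap.id : C →ₗ[A] C) (inj P i ∘ₗ proj P i)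
        LinearMap.id ((P j).coact p)
      rw [coact_inj, h]
      by_cases hij : j = i
      · subst hij
        have h2 : (inj P j ∘ₗ proj P j) ∘ₗ inj P j = inj P j := by
          ext q : 1
          exact congrArg (inj P j) (proj_inj P j q)
        rw [h2, LinearMap.comp_apply, proj_inj, coact_inj]
        rfl
      · have h2 : (inj P i ∘ₗ proj P i) ∘ₗ inj P j = 0 := by
          ext q : 1
          exact (congrArg (inj P i) (proj_inj_ne P hij q)).trans (map_zero _)
        rw [h2, LinearMap.comp_apply, proj_inj_ne P hij, map_zero, map_zero, map_zero_left]⟩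

theorem idem_smul (i : ι) (u : sum P) : idem P i • u = inj P i (proj P i u) := rfl

theorem smul_def (M : RightComod A C) (t : M.End) (u : M) : t • u = t.1 u := rfl

variable [∀ i, Module.Finite Aᵐᵒᵖ (P i)] [∀ i, Module.Projective Aᵐᵒᵖ (P i)]

/-- The size of the chosen dual basis of `Pᵢ`. -/
noncomputable def dbSize (i : ι) : ℕ := (exists_dualBasis A (P i)).choose

/-- The elements `e_α` of the chosen dual basis of `Pᵢ`. -/
noncomputable def dbVec (i : ι) : Fin (dbSize P i) → P i :=
  (exists_dualBasis A (P i)).choose_spec.choose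

/-- The functionals `e_α^*` of the chosen dual basis of `Pᵢ`. -/
noncomputable def dbFun (i : ι) : Fin (dbSize P i) → RDual A (P i) :=
  (exists_dualBasis A (P i)).choose_spec.choose_spec.choose

theorem dualBasis_sum (i : ι) (p : P i) : ∑ k, op (dbFun P i k p) • dbVec P i k = p :=
  (exists_dualBasis A (P i)).choose_spec.choose_spec.choose_spec p

/-- The map `u ↦ ∑_α ιᵢ(e_α) ⊗_A (e_α^* πᵢ ⊗_T u)`. -/
noncomputable def basisMap (i : ι) :
    sum P →ₗ[Aᵐᵒᵖ] BTensor A (sum P) (DualTensor (sum P)) where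
  toFun u := ∑ k, tmul A (inj P i (dbVec P i k))
    (tmul (sum P).End ((dbFun P i k).comp (proj P i)) u)
  map_add' u v := by simp only [tmul_add, Finset.sum_add_distrib]
  map_smul' a u := by
    rw [RingHom.id_apply, Finset.smul_sum]
    rfl

theorem basisMap_apply (i : ι) (u : sum P) : basisMap P i u =
    ∑ k, tmul A (inj P i (dbVec P i k))
      (tmul (sum P).End ((dbFun P i k).comp (proj P i)) u) := rfl

/-- The coaction of the comatrix coring on `Σ = ⨁ᵢ Pᵢ`, determined by
`ιᵢ(p) ↦ ∑_α ιᵢ(e_α) ⊗_A (e_α^* πᵢ ⊗_T ιᵢ(p))`. -/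
noncomputable def comatrixCoact : sum P →ₗ[Aᵐᵒᵖ] BTensor A (sum P) (DualTensor (sum P)) :=
  DirectSum.toModule Aᵐᵒᵖ ι _ (fun i => basisMap P i ∘ₗ inj P i)

theorem comatrixCoact_inj (i : ι) (p : P i) :
    comatrixCoact P (inj P i p) = basisMap P i (inj P i p) :=
  DirectSum.toModule_lof Aᵐᵒᵖ (φ := fun i => basisMap P i ∘ₗ inj P i) i p

theorem basisMap_idem (i : ι) (u : sum P) : basisMap P i (inj P i (proj P i u)) =
    basisMap P i u := by
  rw [basisMap_apply, basisMap_apply]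
  refine Finset.sum_congr rfl fun k _ => congrArg _ ?_
  rw [← idem_smul, ← smul_tmul]
  congr 1
  refine RDual.ext fun v => ?_
  rw [RDual.op_smul_apply, idem_smul, RDual.comp_apply, RDual.comp_apply, proj_inj]

theorem comatrixCoact_eq_sum (u : sum P) (F : Finset ι)
    (hF : ∑ j ∈ F, inj P j (proj P j u) = u) :
    comatrixCoact P u = ∑ j ∈ F, basisMap P j u := by
  conv_lhs => rw [← hF, map_sum]
  exact Finset.sum_congr rfl fun j _ => by rw [comatrixCoact_inj, basisMap_idem]

theorem basisMap_smul_inj (j i : ι) (t : (sum P).End) (p : P i) :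
    basisMap P j (t • inj P i p) = ∑ k, tmul A (inj P j (proj P j (t • inj P i (dbVec P i k))))
      (tmul (sum P).End ((dbFun P i k).comp (proj P i)) (inj P i p)) := by
  have h1 : ∀ l, tmul (sum P).End ((dbFun P j l).comp (proj P j)) (t • inj P i p) =
      ∑ k, dbFun P j l (proj P j (t • inj P i (dbVec P i k))) •
        tmul (sum P).End ((dbFun P i k).comp (proj P i)) (inj P i p) := by
    intro l
    have h2 : t • inj P i p = (t * idem P i) • inj P i p := by
      rw [mul_smul, idem_smul, proj_inj]
    rw [h2, ← smul_tmul]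
    simp only [left_smul_tmul]
    rw [← sum_tmul]
    congr 1
    refine RDual.ext fun v => ?_
    rw [RDual.sum_apply, RDual.op_smul_apply, mul_smul, idem_smul, RDual.comp_apply]
    conv_lhs => rw [← dualBasis_sum P i (proj P i v)]
    simp only [smul_def, map_sum, map_smul, RDual.smul_apply, RDual.comp_apply, op_smul_eq_mul]
  rw [basisMap_apply]
  simp only [h1, tmul_sum]
  rw [Finset.sum_comm]
  refine Finset.sum_congr rfl fun k _ => ?_
  simp only [← smul_tmul]
  rw [← sum_tmul]
  congr 1
  conv_rhs => rw [← dualBasis_sum P j (proj P j _), map_sum]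
  simp only [map_smul]

/-- The coaction of the comatrix coring is `T`-linear. -/
theorem comatrixCoact_smul (t : (sum P).End) (u : sum P) :
    comatrixCoact P (t • u) = t • comatrixCoact P u := by
  induction u using sum_induction with
  | h0 => simp
  | ha x y hx hy => simp only [smul_add, map_add, hx, hy]
  | hi i p =>
    obtain ⟨F₀, h₀⟩ := exists_finset P (t • inj P i p)
    choose G hG using fun k => exists_finset P (t • inj P i (dbVec P i k))
    let F := F₀ ∪ Finset.univ.biUnion G
    rw [comatrixCoact_eq_sum P _ F (h₀ F Finset.subset_union_left), comatrixCoact_inj,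
      basisMap_apply]
    simp only [basisMap_smul_inj, Finset.smul_sum, left_smul_tmul]
    rw [Finset.sum_comm]
    refine Finset.sum_congr rfl fun k _ => ?_
    rw [← sum_tmul, hG k F ((Finset.subset_biUnion_of_mem G (Finset.mem_univ k)).trans
      Finset.subset_union_right)]

/-- The comultiplication of `Σ^* ⊗_T Σ`, given by
`Δ(φ ⊗_T ιᵢ(p)) = ∑_α (φ ⊗_T ιᵢ(e_α)) ⊗_A (e_α^* πᵢ ⊗_T ιᵢ(p))`. -/
noncomputable def comatrixComul : BimodHom A (DualTensor (sum P))
    (BTensor A (DualTensor (sum P)) (DualTensor (sum P))) where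
  toAddMonoidHom := lift
    (AddMonoidHom.mk' (fun φ : RDual A (sum P) =>
      (map (tensorLeft φ) LinearMap.id).comp (comatrixCoact P).toAddMonoidHom)
      (fun φ ψ => by
        ext u
        have h : tensorLeft (φ + ψ) = tensorLeft φ + tensorLeft ψ := by
          ext v : 1
          exact add_tmul φ ψ v
        change map (tensorLeft (φ + ψ)) LinearMap.id (comatrixCoact P u) = _
        rw [h, map_add_left]
        rfl))
    (fun φ t u => by
      change map (tensorLeft (op t • φ)) LinearMap.id (comatrixCoact P u) =
        map (tensorLeft φ) LinearMap.id (comatrixCoact P (t • u))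
      rw [comatrixCoact_smul]
      generalize comatrixCoact P u = y
      induction y using BTensor.induction with
      | h0 => simp
      | ht m c => simp [smul_tmul]
      | ha x y hx hy => simp only [smul_add, map_add, hx, hy])
  map_left a x := by
    change lift _ _ (a • x) = a • lift _ _ x
    induction x using BTensor.induction with
    | h0 => simp
    | ht φ u =>
      change map (tensorLeft (a • φ)) LinearMap.id (comatrixCoact P u) =
        a • map (tensorLeft φ) LinearMap.id (comatrixCoact P u)
      generalize comatrixCoact P u = y
      induction y using BTensor.induction with
      | h0 => simp
      | ht m c => simp
      | ha x y hx hy => simp only [smul_add, map_add, hx, hy]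
    | ha x y hx hy => simp only [smul_add, map_add, hx, hy]
  map_right a x := by
    change lift _ _ (op a • x) = op a • lift _ _ x
    induction x using BTensor.induction with
    | h0 => simp
    | ht φ u =>
      change map (tensorLeft φ) LinearMap.id (comatrixCoact P (op a • u)) =
        op a • map (tensorLeft φ) LinearMap.id (comatrixCoact P u)
      rw [map_smul]
      generalize comatrixCoact P u = y
      induction y using BTensor.induction with
      | h0 => simp
      | ht m c => simp
      | ha x y hx hy => simp only [smul_add, map_add, hx, hy]
    | ha x y hx hy => simp only [smul_add, map_add, hx, hy]

theorem comatrixComul_tmul_inj (φ : RDual A (sum P)) (i : ι) (p : P i) :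
    comatrixComul P (tmul (sum P).End φ (inj P i p)) =
      ∑ k, tmul A (tmul (sum P).End φ (inj P i (dbVec P i k)))
        (tmul (sum P).End ((dbFun P i k).comp (proj P i)) (inj P i p)) := by
  change map (tensorLeft φ) LinearMap.id (comatrixCoact P (inj P i p)) = _
  rw [comatrixCoact_inj, basisMap_apply, map_sum]
  rfl

@[elab_as_elim]
theorem dualTensor_induction {q : DualTensor (sum P) → Prop} (x : DualTensor (sum P))
    (h0 : q 0) (hi : ∀ φ i p, q (tmul (sum P).End φ (inj P i p)))
    (ha : ∀ x y, q x → q y → q (x + y)) : q x := by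
  induction x using BTensor.induction with
  | h0 => exact h0
  | ha x y hx hy => exact ha x y hx hy
  | ht φ u =>
    induction u using sum_induction with
    | h0 => rw [tmul_zero]; exact h0
    | hi i p => exact hi φ i p
    | ha x y hx hy => rw [tmul_add]; exact ha _ _ hx hy

/-- The infinite comatrix coring `Σ^* ⊗_T Σ`, where `Σ = ⨁ᵢ Pᵢ` and `T = End_C(Σ)`. -/
noncomputable instance comatrixCoring : Coring A (DualTensor (sum P)) where
  comul := comatrixComul P
  counit := evalHom (sum P)
  coassoc x := by
    induction x using dualTensor_induction with
    | h0 => simp only [map_zero]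
    | ha x y hx hy => simp only [map_add, hx, hy]
    | hi φ i p =>
      rw [comatrixComul_tmul_inj]
      simp only [map_sum, map_tmul, BimodHom.right_apply, BimodHom.left_apply,
        comatrixComul_tmul_inj, sum_tmul, tmul_sum, assoc_tmul, LinearMap.id_apply]
      rw [Finset.sum_comm]
  counit_left x := by
    induction x using dualTensor_induction with
    | h0 => simp only [map_zero]
    | ha x y hx hy => simp only [map_add, hx, hy]
    | hi φ i p =>
      rw [comatrixComul_tmul_inj]
      simp only [map_sum, map_tmul, BimodHom.right_apply, evalHom_tmul, LinearMap.id_apply,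
        lid_tmul, left_smul_tmul]
      rw [← sum_tmul]
      have h : ∑ k, φ (inj P i (dbVec P i k)) • (dbFun P i k).comp (proj P i) =
          op (idem P i) • φ := by
        refine RDual.ext fun v => ?_
        rw [RDual.sum_apply, RDual.op_smul_apply, idem_smul]
        conv_rhs => rw [← dualBasis_sum P i (proj P i v)]
        simp only [map_sum, map_smul, RDual.smul_apply, RDual.comp_apply, op_smul_eq_mul]
      rw [h, smul_tmul, idem_smul, proj_inj]
  counit_right x := by
    induction x using dualTensor_induction with
    | h0 => simp only [map_zero]
    | ha x y hx hy => simp only [map_add, hx, hy]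
    | hi φ i p =>
      rw [comatrixComul_tmul_inj]
      simp only [map_sum, map_tmul, BimodHom.left_apply, evalHom_tmul, LinearMap.id_apply,
        rid_tmul, right_smul_tmul, RDual.comp_apply, proj_inj]
      rw [← tmul_sum]
      simp only [← map_smul]
      rw [← map_sum, dualBasis_sum]

end Comatrix

end NCoring

/-!
The map `can` is compatible with the coring structures for any family of comodules that are
finitely generated and projective over `A`; what has to be shown is that it is bijective.

By counitality, `φ ↦ can (φ ⊗ -)` identifies functionals on a comodule `M` with colinear maps from
`M` to the regular comodule `C` (`can_tmul_counit_comp`, `counit_can_tmul`). As the `Pᵢ` separate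
morphisms and quotients of comodules by subcomodules are again comodules, every comodule is the sum
of the images of the colinear maps from the `Pᵢ` (`mem_of_isSeparating`); for `C` this says that
`can` is surjective.

For injectivity, cover `C` by the coproduct `Q` of copies of the `Pᵢ`, one for each functional
`φ : Pᵢ → A`, the component at `φ` being `can (φ ⊗ -)`. This map `Q → C` is the composite of `can`
and a surjection `coverToTensor : Q → Σ^* ⊗_T Σ`, so it suffices that `coverToTensor` vanishes on
the kernel of the additive map underlying `Q → C`. That kernel need not be a subcomodule when `C` is
not flat as a left `A`-module, and this is where abelianness enters: the epimorphism `Q → C` is a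
cokernel in the category of comodules, and cokernels are computed on underlying modules. Hence the
kernel is the range of a colinear map `g : W → Q`, and it is enough to treat `g ∘ h` for
`h : Pⱼ → W` colinear (`coverToTensor_comp_eq_zero`). As `Pⱼ` is finitely generated, `g ∘ h`
meets only finitely many summands of `Q`, with colinear components `tₖ : Pⱼ → Pᵢₖ`, and in
`Σ^* ⊗_T Σ` these can be moved across the tensor sign:
`∑ φₖ πᵢₖ ⊗ ιᵢₖ tₖ p = (∑ φₖ tₖ) πⱼ ⊗ ιⱼ p`, where `∑ φₖ tₖ` is the counit of `C` composed with
`Pⱼ → Q → C`, that is, zero.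
-/

open CategoryTheory

namespace NCoring

open BTensor RightComod

variable {A : Type u} [Ring A] {C : Type u} [AddCommGroup C] [Module A C]
    [Module Aᵐᵒᵖ C] [SMulCommClass A Aᵐᵒᵖ C] [Coring A C]

/-! ### The canonical map and the regular comodule -/

theorem counit_can_tmul (M : RightComod A C) (φ : RDual A M) (u : M) :
    Coring.counit (A := A) (can M (tmul M.End φ u)) = φ u := by
  have h : ∀ y : BTensor A M C,
      Coring.counit (A := A) (lid A C (map φ.lin LinearMap.id y)) =
        φ (rid A M (map LinearMap.id (Coring.counit (A := A) (C := C)).left y)) := by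
    intro y
    induction y using BTensor.induction with
    | h0 => simp only [map_zero]
    | ht m c =>
      simp only [map_tmul, lid_tmul, rid_tmul, RDual.lin_apply, LinearMap.id_apply, map_smul,
        op_smul_eq_mul, BimodHom.left_apply]
      exact (Coring.counit (A := A) (C := C)).map_left (φ m) c
    | ha x y hx hy => simp only [map_add, hx, hy]
  rw [can_tmul, h, M.counit]

/-- The map `can (φ ⊗ -)` is colinear from `M` to the regular comodule `C`. -/
theorem comul_can_tmul (M : RightComod A C) (φ : RDual A M) (u : M) :
    Coring.comul (A := A) (can M (tmul M.End φ u)) =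
      map ((can M).right ∘ₗ tensorLeft φ) LinearMap.id (M.coact u) := by
  have h1 : ∀ y : BTensor A M C,
      Coring.comul (A := A) (lid A C (map φ.lin LinearMap.id y)) =
        lid A (BTensor A C C) (map φ.lin LinearMap.id
          (map LinearMap.id (Coring.comul (A := A) (C := C)).left y)) := by
    intro y
    induction y using BTensor.induction with
    | h0 => simp only [map_zero]
    | ht m c => exact (Coring.comul (A := A) (C := C)).map_left (φ m) c
    | ha x y hx hy => simp only [map_add, hx, hy]
  have h2 : ∀ (w : BTensor A M C) (c : C),
      lid A (BTensor A C C) (map φ.lin LinearMap.id (assoc (tmul A w c))) =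
        tmul A (lid A C (map φ.lin LinearMap.id w)) c := by
    intro w c
    induction w using BTensor.induction with
    | h0 => simp
    | ht m c => simp
    | ha x y hx hy => simp only [map_add, add_tmul, hx, hy]
  have h3 : ∀ y : BTensor A M C,
      lid A (BTensor A C C) (map φ.lin LinearMap.id (assoc (map M.coact LinearMap.id y))) =
        map ((can M).right ∘ₗ tensorLeft φ) LinearMap.id y := by
    intro y
    induction y using BTensor.induction with
    | h0 => simp only [map_zero]
    | ht m c => exact h2 _ c
    | ha x y hx hy => simp only [map_add, hx, hy]
  rw [can_tmul, h1, ← M.coassoc, h3]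

theorem isCoringHom_can {ι : Type u} [DecidableEq ι] (P : ι → RightComod A C)
    [∀ i, Module.Finite Aᵐᵒᵖ (P i)] [∀ i, Module.Projective Aᵐᵒᵖ (P i)] :
    IsCoringHom (can (sum P)) where
  map_counit x := by
    change _ = evalHom (sum P) x
    induction x using BTensor.induction with
    | h0 => simp only [map_zero]
    | ht φ u => exact counit_can_tmul _ φ u
    | ha x y hx hy => simp only [map_add, hx, hy]
  map_comul x := by
    change _ = map (can (sum P)).right (can (sum P)).left (comatrixComul P x)
    induction x using dualTensor_induction with
    | h0 => simp only [map_zero]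
    | ha x y hx hy => simp only [map_add, hx, hy]
    | hi φ i p =>
      rw [comul_can_tmul, comatrixComul_tmul_inj, map_sum, coact_inj, map_map]
      simp only [map_tmul, BimodHom.right_apply, BimodHom.left_apply, can_tmul (sum P)
        (RDual.comp _ _), coact_inj, map_map]
      generalize (P i).coact p = y
      induction y using BTensor.induction with
      | h0 => simp
      | ha x y hx hy => simp only [map_add, tmul_add, Finset.sum_add_distrib, hx, hy]
      | ht m c =>
        have h : ∀ k, ((dbFun P i k).comp (proj P i)).lin (inj P i m) = dbFun P i k m :=
          fun k => congrArg (dbFun P i k) (proj_inj P i m)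
        simp only [map_tmul, LinearMap.comp_apply, lid_tmul, LinearMap.id_apply, h, ← smul_tmul]
        rw [← sum_tmul]
        congr 1
        conv_lhs => rw [← dualBasis_sum P i m, map_sum, map_sum, map_sum]
        simp only [map_smul]
        rfl

variable (A C) in
/-- The coring `C` as a right comodule over itself. -/
def regular : RightComod A C where
  carrier := C
  coact := (Coring.comul (A := A) (C := C)).right
  coassoc := Coring.coassoc
  counit := Coring.counit_right

/-- The morphism `can (φ ⊗ -)` from `M` to the regular comodule. -/
def canHom (M : RightComod A C) (φ : RDual A M) : M ⟶ regular A C :=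
  Hom.mk ((can M).right ∘ₗ tensorLeft φ) (fun u => (comul_can_tmul M φ u).symm)

variable (A C) in
/-- The counit as a functional on the regular comodule. -/
def regularCounit : RDual A (regular A C) := (Coring.counit (A := A) (C := C)).right

/-- A morphism to the regular comodule is determined by its composite with the counit. -/
theorem can_tmul_counit_comp (M : RightComod A C) (f : M ⟶ regular A C) (u : M) :
    can M (tmul M.End ((regularCounit A C).comp f.toLinearMap) u) = f.toLinearMap u := by
  have h : map (regularCounit A C).lin LinearMap.id
      (map f.toLinearMap (LinearMap.id : C →ₗ[A] C) (M.coact u)) =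
      map (regularCounit A C).lin LinearMap.id ((regular A C).coact (f.toLinearMap u)) :=
    congrArg _ (f.colinear u)
  rw [map_map] at h
  exact (congrArg (lid A C) h).trans (Coring.counit_left (A := A) (C := C) (f.toLinearMap u))

/-! ### Quotient comodules and generation -/

namespace RightComod

/-- The map `f ⊗ C` as a right linear map. -/
def mapCoring {M N : Type*} [AddCommGroup M] [Module Aᵐᵒᵖ M] [AddCommGroup N] [Module Aᵐᵒᵖ N]
    (f : M →ₗ[Aᵐᵒᵖ] N) : BTensor A M C →ₗ[Aᵐᵒᵖ] BTensor A N C where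
  toFun := map f LinearMap.id
  map_add' := map_add _
  map_smul' a x := by
    rw [RingHom.id_apply]
    induction x using BTensor.induction with
    | h0 => simp
    | ht m c => rfl
    | ha x y hx hy => simp only [smul_add, map_add, hx, hy]

/-- The quotient of a comodule by a submodule `N` with `ρ(N)` in the kernel of
`M ⊗ C → M / N ⊗ C`. -/
def quotient (M : RightComod A C) (N : Submodule Aᵐᵒᵖ M)
    (hN : ∀ n ∈ N, map N.mkQ (LinearMap.id : C →ₗ[A] C) (M.coact n) = 0) : RightComod A C where
  carrier := M ⧸ N
  coact := N.liftQ (mapCoring N.mkQ ∘ₗ M.coact) hN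
  coassoc m := by
    obtain ⟨m, rfl⟩ := N.mkQ_surjective m
    change assoc (map (N.liftQ (mapCoring N.mkQ ∘ₗ M.coact) hN) LinearMap.id
      (map N.mkQ LinearMap.id (M.coact m))) = map LinearMap.id _ (map N.mkQ LinearMap.id (M.coact m))
    have h : ∀ x : BTensor A M C,
        assoc (map (N.liftQ (mapCoring N.mkQ ∘ₗ M.coact) hN) LinearMap.id
          (map N.mkQ LinearMap.id x)) =
        map N.mkQ LinearMap.id (assoc (map M.coact LinearMap.id x)) := by
      intro x
      induction x using BTensor.induction with
      | h0 => simp only [map_zero]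
      | ha x y hx hy => simp only [map_add, hx, hy]
      | ht m c =>
        change assoc (tmul A (map N.mkQ LinearMap.id (M.coact m)) c) =
          map N.mkQ LinearMap.id (assoc (tmul A (M.coact m) c))
        generalize M.coact m = y
        induction y using BTensor.induction with
        | h0 => simp
        | ht m' n' => rfl
        | ha x y hx hy => simp only [map_add, add_tmul, hx, hy]
    rw [h, M.coassoc, map_map, map_map]
    rfl
  counit m := by
    obtain ⟨m, rfl⟩ := N.mkQ_surjective m
    change rid A _ (map LinearMap.id _ (map N.mkQ LinearMap.id (M.coact m))) = N.mkQ m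
    have h : ∀ x : BTensor A M C,
        rid A (M ⧸ N) (map LinearMap.id (Coring.counit (A := A) (C := C)).left
          (map N.mkQ LinearMap.id x)) =
        N.mkQ (rid A M (map LinearMap.id (Coring.counit (A := A) (C := C)).left x)) := by
      intro x
      induction x using BTensor.induction with
      | h0 => simp only [map_zero]
      | ha x y hx hy => simp only [map_add, hx, hy]
      | ht m c => rfl
    rw [h, M.counit]

/-- The projection onto a quotient comodule. -/
def quotientHom (M : RightComod A C) (N : Submodule Aᵐᵒᵖ M)
    (hN : ∀ n ∈ N, map N.mkQ (LinearMap.id : C →ₗ[A] C) (M.coact n) = 0) : M ⟶ M.quotient N hN :=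
  Hom.mk N.mkQ (fun _ => rfl)

/-- The zero morphism of comodules. -/
def zeroHom (M N : RightComod A C) : M ⟶ N :=
  Hom.mk 0 (fun m => (map_zero_left _ (M.coact m)).trans (map_zero N.coact).symm)

/-- If `f` takes values in `N`, the coaction on the values of `f` dies in `M / N ⊗ C`. -/
theorem map_mkQ_coact_apply {M L : RightComod A C} (N : Submodule Aᵐᵒᵖ M) (f : L ⟶ M)
    (hf : ∀ l, f.toLinearMap l ∈ N) (l : L) :
    map N.mkQ (LinearMap.id : C →ₗ[A] C) (M.coact (f.toLinearMap l)) = 0 := by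
  rw [← f.colinear l, map_map]
  have h : N.mkQ ∘ₗ f.toLinearMap = 0 := by
    ext l : 1
    exact (Submodule.Quotient.mk_eq_zero N).2 (hf l)
  rw [h, map_zero_left]

theorem zero_toLinearMap [Preadditive (RightComod A C)] (M N : RightComod A C) :
    Hom.toLinearMap (0 : M ⟶ N) = 0 := by
  -- The preadditive structure is arbitrary, but its zero absorbs the zero linear map.
  have h : (0 : M ⟶ N) = (0 : M ⟶ N) ≫ zeroHom N N := Limits.zero_comp.symm
  rw [h]
  rfl

end RightComod

section Generation

variable {ι : Type u} (P : ι → RightComod A C)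

/-- A comodule is the sum of the images of the morphisms from a separating family. -/
theorem mem_of_isSeparating (hgen : (ObjectProperty.ofObj P).IsSeparating) (M : RightComod A C)
    (N : Submodule Aᵐᵒᵖ M) (hN : ∀ i (h : P i ⟶ M) (p : P i), h.toLinearMap p ∈ N) (m : M) :
    m ∈ N := by
  let N' : Submodule Aᵐᵒᵖ M := ⨆ x : Σ i, P i ⟶ M, LinearMap.range x.2.toLinearMap
  have hle : N' ≤ N := by
    refine iSup_le fun x => ?_
    rintro _ ⟨p, rfl⟩
    exact hN x.1 x.2 p
  have hmem : ∀ i (h : P i ⟶ M) (p : P i), h.toLinearMap p ∈ N' := fun i h p =>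
    le_iSup (fun x : Σ i, P i ⟶ M => LinearMap.range x.2.toLinearMap) ⟨i, h⟩ ⟨p, rfl⟩
  have hker : N' ≤ LinearMap.ker (mapCoring N'.mkQ ∘ₗ M.coact) := by
    refine iSup_le fun x => ?_
    rintro _ ⟨p, rfl⟩
    exact map_mkQ_coact_apply N' x.2 (hmem x.1 x.2) p
  have hq : M.quotientHom N' hker = zeroHom M _ := by
    refine hgen _ _ fun G hG h => ?_
    obtain ⟨i⟩ := hG
    refine Hom.ext (LinearMap.ext fun p => ?_)
    exact (Submodule.Quotient.mk_eq_zero N').2 (hmem i h p)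
  refine hle ((Submodule.Quotient.mk_eq_zero N').1 ?_)
  exact LinearMap.congr_fun (congrArg Hom.toLinearMap hq) m

/-- Epimorphisms of comodules are cokernels if the category is abelian, and cokernels of comodules
are computed on modules: the kernel of an epimorphism is the range of a morphism of comodules. -/
theorem exists_ker_eq_range (habelian : Nonempty (Abelian (RightComod A C)))
    {M N : RightComod A C} (f : M ⟶ N) [Epi f] :
    ∃ (W : RightComod A C) (g : W ⟶ M),
      LinearMap.ker f.toLinearMap = LinearMap.range g.toLinearMap := by
  obtain ⟨_⟩ := habelian
  obtain ⟨⟨W, g, w, hc⟩⟩ := IsNormalEpiCategory.normalEpiOfEpi f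
  refine ⟨W, g, le_antisymm (fun m hm => ?_) ?_⟩
  · let R := LinearMap.range g.toLinearMap
    have hR : ∀ n ∈ R, map R.mkQ (LinearMap.id : C →ₗ[A] C) (M.coact n) = 0 := by
      rintro _ ⟨l, rfl⟩
      exact map_mkQ_coact_apply R g (fun l => ⟨l, rfl⟩) l
    have hq : g ≫ M.quotientHom R hR = 0 := by
      refine Hom.ext ((LinearMap.ext fun l => ?_).trans (zero_toLinearMap _ _).symm)
      exact (Submodule.Quotient.mk_eq_zero R).2 ⟨l, rfl⟩
    obtain ⟨d, hd⟩ := Limits.CokernelCofork.IsColimit.desc' hc _ hq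
    have h : d.toLinearMap (f.toLinearMap m) = R.mkQ m :=
      LinearMap.congr_fun (congrArg Hom.toLinearMap hd) m
    rw [LinearMap.mem_ker.1 hm, map_zero] at h
    exact (Submodule.Quotient.mk_eq_zero R).1 h.symm
  · rintro _ ⟨l, rfl⟩
    exact LinearMap.congr_fun ((congrArg Hom.toLinearMap w).trans (zero_toLinearMap _ _)) l

end Generation

/-! ### The cover of the coring by copies of the generators -/

section Cover

variable {ι : Type u} [DecidableEq ι] (P : ι → RightComod A C)

/-- The canonical injection into a coproduct of comodules, as a morphism. -/
def injHom (i : ι) : P i ⟶ sum P := Hom.mk (inj P i) (fun p => (coact_inj P i p).symm)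

/-- The canonical projection from a coproduct of comodules, as a morphism. -/
def projHom (i : ι) : sum P ⟶ P i := Hom.mk (proj P i) (fun u => by
  induction u using sum_induction with
  | h0 => simp only [map_zero]
  | ha x y hx hy => simp only [map_add, hx, hy]
  | hi j p =>
    rw [coact_inj, map_map]
    by_cases hij : j = i
    · subst hij
      have h : proj P j ∘ₗ inj P j = LinearMap.id := by
        ext q : 1
        exact proj_inj P j q
      rw [h, proj_inj]
      exact map_id_id _
    · have h : proj P i ∘ₗ inj P j = 0 := by
        ext q : 1
        exact proj_inj_ne P hij q
      rw [h, proj_inj_ne P hij, map_zero, map_zero_left])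

/-- A colinear map `Pⱼ → Pᵢ` can be moved across the tensor sign of `Σ^* ⊗_T Σ`. -/
theorem tmul_comp_proj_inj {i j : ι} (t : P j ⟶ P i) (φ : RDual A (P i)) (p : P j) :
    tmul (sum P).End (φ.comp (proj P i)) (inj P i (t.toLinearMap p)) =
      tmul (sum P).End ((φ.comp t.toLinearMap).comp (proj P j)) (inj P j p) := by
  let s : (sum P).End := ⟨(projHom P j ≫ t ≫ injHom P i).toLinearMap,
    (projHom P j ≫ t ≫ injHom P i).colinear⟩
  have h1 : inj P i (t.toLinearMap p) = s • inj P j p := by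
    change _ = inj P i (t.toLinearMap (proj P j (inj P j p)))
    rw [proj_inj]
  rw [h1, ← smul_tmul]
  congr 1
  exact RDual.ext fun v => congrArg φ (proj_inj P i _)

theorem tmul_eq_tmul_comp_proj (φ : RDual A (sum P)) (i : ι) (p : P i) :
    tmul (sum P).End φ (inj P i p) =
      tmul (sum P).End ((φ.comp (inj P i)).comp (proj P i)) (inj P i p) := by
  have h : inj P i p = idem P i • inj P i p := by rw [idem_smul, proj_inj]
  conv_lhs => rw [h, ← smul_tmul]
  rfl

theorem can_tmul_comp_proj_inj (i : ι) (φ : RDual A (P i)) (p : P i) :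
    can (sum P) (tmul (sum P).End (φ.comp (proj P i)) (inj P i p)) =
      can (P i) (tmul (P i).End φ p) := by
  rw [can_tmul, can_tmul, coact_inj, map_map]
  have h : (φ.comp (proj P i)).lin ∘ₗ inj P i = φ.lin := by
    ext q : 1
    exact congrArg φ (proj_inj P i q)
  rw [h]
  rfl

/-- The family with one copy of `Pᵢ` for each functional on `Pᵢ`. -/
abbrev coverFamily (k : Σ i, RDual A (P i)) : RightComod A C := P k.1

open Classical in
/-- The coproduct of copies of the `Pᵢ`, one for each functional on `Pᵢ`. -/
noncomputable abbrev cover : RightComod A C := sum (coverFamily P)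

open Classical in
/-- The map `Q → Σ^* ⊗_T Σ` from the cover, which is `φ πᵢ ⊗ ιᵢ` on the copy of `Pᵢ` at `φ`. -/
noncomputable def coverToTensor : cover P →ₗ[Aᵐᵒᵖ] DualTensor (sum P) :=
  DirectSum.toModule Aᵐᵒᵖ (Σ i, RDual A (P i)) _
    (fun k => tensorLeft (k.2.comp (proj P k.1)) ∘ₗ inj P k.1)

open Classical in
theorem coverToTensor_inj (k : Σ i, RDual A (P i)) (p : P k.1) :
    coverToTensor P (inj (coverFamily P) k p) =
      tmul (sum P).End (k.2.comp (proj P k.1)) (inj P k.1 p) :=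
  DirectSum.toModule_lof Aᵐᵒᵖ
    (φ := fun k : Σ i, RDual A (P i) => tensorLeft (k.2.comp (proj P k.1)) ∘ₗ inj P k.1) k p

theorem coverToTensor_surjective : Function.Surjective (coverToTensor P) := by
  classical
  intro x
  change x ∈ LinearMap.range (coverToTensor P)
  induction x using BTensor.induction with
  | h0 => exact zero_mem _
  | ha x y hx hy => exact add_mem hx hy
  | ht φ u =>
    induction u using sum_induction with
    | h0 => rw [tmul_zero]; exact zero_mem _
    | ha x y hx hy => rw [tmul_add]; exact add_mem hx hy
    | hi i p =>
      refine ⟨inj (coverFamily P) ⟨i, φ.comp (inj P i)⟩ p, ?_⟩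
      rw [tmul_eq_tmul_comp_proj]
      exact coverToTensor_inj P ⟨i, φ.comp (inj P i)⟩ p

/-- The morphism from the cover to the regular comodule, which is `can (φ ⊗ -)` on the copy of `Pᵢ`
at `φ`. -/
noncomputable def coverHom : cover P ⟶ regular A C :=
  Hom.mk ((can (sum P)).right ∘ₗ coverToTensor P) (fun u => by
    classical
    induction u using sum_induction with
    | h0 => simp only [map_zero]
    | ha x y hx hy => simp only [map_add, hx, hy]
    | hi k p =>
      have h : ((can (sum P)).right ∘ₗ coverToTensor P) ∘ₗ inj (coverFamily P) k =
          (canHom (P k.1) k.2).toLinearMap := by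
        ext q : 1
        exact (congrArg _ (coverToTensor_inj P k q)).trans (can_tmul_comp_proj_inj P k.1 k.2 q)
      have h2 := (canHom (P k.1) k.2).colinear p
      rw [← h] at h2
      exact (congrArg _ (coact_inj (coverFamily P) k p)).trans
        ((map_map _ _ _ _ _).trans h2))

theorem coverHom_apply (u : cover P) :
    (coverHom P).toLinearMap u = can (sum P) (coverToTensor P u) := rfl

theorem coverHom_surjective (hgen : (ObjectProperty.ofObj P).IsSeparating) :
    Function.Surjective (coverHom P).toLinearMap := by
  classical
  intro c
  refine mem_of_isSeparating P hgen (regular A C) (LinearMap.range (coverHom P).toLinearMap)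
    (fun i h p => ?_) c
  let φ : RDual A (P i) := (regularCounit A C).comp h.toLinearMap
  have h1 : can (sum P) (coverToTensor P (inj (coverFamily P) ⟨i, φ⟩ p)) =
      can (P i) (tmul (P i).End φ p) := by
    rw [coverToTensor_inj P ⟨i, φ⟩ p, can_tmul_comp_proj_inj]
  rw [can_tmul_counit_comp (P i) h p] at h1
  exact ⟨inj (coverFamily P) ⟨i, φ⟩ p, h1⟩

/-- A linear map from a finitely generated module to a coproduct takes values in a finite
subcoproduct. -/
theorem exists_finset_of_finite {M : Type*} [AddCommGroup M] [Module Aᵐᵒᵖ M]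
    [Module.Finite Aᵐᵒᵖ M] (f : M →ₗ[Aᵐᵒᵖ] sum P) :
    ∃ F : Finset ι, ∀ m, ∑ j ∈ F, inj P j (proj P j (f m)) = f m := by
  obtain ⟨S, hS⟩ := Module.Finite.fg_top (R := Aᵐᵒᵖ) (M := M)
  choose G hG using fun m => exists_finset P (f m)
  refine ⟨S.biUnion G, fun m => ?_⟩
  have hm : m ∈ Submodule.span Aᵐᵒᵖ (S : Set M) := hS ▸ Submodule.mem_top
  induction hm using Submodule.span_induction with
  | mem x hx => exact hG x _ (Finset.subset_biUnion_of_mem G hx)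
  | zero => simp
  | add x y _ _ hx hy => simp only [map_add, Finset.sum_add_distrib, hx, hy]
  | smul a x _ hx => simp only [map_smul, ← Finset.smul_sum, hx]

/-- A morphism from a finitely generated `Pⱼ` that becomes zero in `C` becomes zero in
`Σ^* ⊗_T Σ`. -/
theorem coverToTensor_comp_eq_zero (j : ι) [Module.Finite Aᵐᵒᵖ (P j)] (g : P j ⟶ cover P)
    (hg : ∀ p, (coverHom P).toLinearMap (g.toLinearMap p) = 0) (p : P j) :
    coverToTensor P (g.toLinearMap p) = 0 := by
  classical
  obtain ⟨F, hF⟩ := exists_finset_of_finite (coverFamily P) g.toLinearMap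
  let t (k : Σ i, RDual A (P i)) : P j ⟶ P k.1 := g ≫ projHom (coverFamily P) k
  have key : ∀ q, coverToTensor P (g.toLinearMap q) =
      tmul (sum P).End ((∑ k ∈ F, k.2.comp (t k).toLinearMap).comp (proj P j)) (inj P j q) := by
    intro q
    have hs : (∑ k ∈ F, k.2.comp (t k).toLinearMap).comp (proj P j) =
        ∑ k ∈ F, (k.2.comp (t k).toLinearMap).comp (proj P j) :=
      RDual.ext fun v => by simp only [RDual.comp_apply, RDual.sum_apply]
    rw [hs, sum_tmul, ← hF q, map_sum]
    refine Finset.sum_congr rfl fun k _ => ?_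
    rw [coverToTensor_inj]
    exact tmul_comp_proj_inj P (t k) k.2 q
  -- The functional in `key` is the counit of `C` composed with `Pⱼ → Q → C`.
  have h0 : ∑ k ∈ F, k.2.comp (t k).toLinearMap = 0 := by
    refine RDual.ext fun q => ?_
    have h := counit_can_tmul (sum P)
      ((∑ k ∈ F, k.2.comp (t k).toLinearMap).comp (proj P j)) (inj P j q)
    rw [← key, ← coverHom_apply, hg q, RDual.comp_apply, proj_inj] at h
    exact h.symm.trans (map_zero (Coring.counit (A := A) (C := C)).toAddMonoidHom)
  rw [key, h0]
  exact zero_tmul _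

theorem can_bijective [∀ i, Module.Finite Aᵐᵒᵖ (P i)]
    (habelian : Nonempty (Abelian (RightComod A C)))
    (hgen : (ObjectProperty.ofObj P).IsSeparating) :
    Function.Bijective (can (sum P)).toAddMonoidHom := by
  have hsurj := coverHom_surjective P hgen
  refine ⟨(injective_iff_map_eq_zero _).2 fun x hx => ?_, fun c => ?_⟩
  · have : Epi (coverHom P) := ⟨fun a b hab => Hom.ext (LinearMap.ext fun c => by
      obtain ⟨u, rfl⟩ := hsurj c
      exact LinearMap.congr_fun (congrArg Hom.toLinearMap hab) u)⟩
    obtain ⟨W, g, hg⟩ := exists_ker_eq_range habelian (coverHom P)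
    obtain ⟨u, rfl⟩ := coverToTensor_surjective P x
    have hu : u ∈ LinearMap.ker (coverHom P).toLinearMap := hx
    rw [hg] at hu
    obtain ⟨w, rfl⟩ := hu
    refine mem_of_isSeparating P hgen W (LinearMap.ker (coverToTensor P ∘ₗ g.toLinearMap))
      (fun j h p => ?_) w
    refine coverToTensor_comp_eq_zero P j (h ≫ g) (fun q => ?_) p
    have hq : g.toLinearMap (h.toLinearMap q) ∈ LinearMap.ker (coverHom P).toLinearMap :=
      hg ▸ ⟨h.toLinearMap q, rfl⟩
    exact hq
  · obtain ⟨u, hu⟩ := hsurj c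
    exact ⟨coverToTensor P u, hu⟩

end Cover

/-! ### Bijective homomorphisms of corings -/

theorem IsCoringHom.isCoringIso {D E : Type*} [AddCommGroup D] [Module A D] [Module Aᵐᵒᵖ D]
    [SMulCommClass A Aᵐᵒᵖ D] [Coring A D] [AddCommGroup E] [Module A E] [Module Aᵐᵒᵖ E]
    [SMulCommClass A Aᵐᵒᵖ E] [Coring A E] {f : BimodHom A D E} (hf : IsCoringHom f)
    (hb : Function.Bijective f.toAddMonoidHom) : IsCoringIso f := by
  let e := AddEquiv.ofBijective f.toAddMonoidHom hb
  have h1 : ∀ d, e.symm (f d) = d := e.symm_apply_apply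
  have h2 : ∀ c, f (e.symm c) = c := e.apply_symm_apply
  let g : BimodHom A E D :=
    { toAddMonoidHom := e.symm.toAddMonoidHom
      map_left := fun a c => hb.1 ((h2 (a • c)).trans
        ((f.map_left a (e.symm c)).trans (congrArg _ (h2 c))).symm)
      map_right := fun a c => hb.1 ((h2 (op a • c)).trans
        ((f.map_right a (e.symm c)).trans (congrArg _ (h2 c))).symm) }
  refine ⟨hf, g, ⟨fun c => ?_, fun c => ?_⟩, h1, h2⟩
  · have h3 : g.right ∘ₗ f.right = LinearMap.id := LinearMap.ext h1
    have h4 : g.left ∘ₗ f.left = LinearMap.id := LinearMap.ext h1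
    obtain ⟨d, rfl⟩ := hb.2 c
    change Coring.comul (A := A) (e.symm (f d)) = map g.right g.left (Coring.comul (A := A) (f d))
    rw [h1, hf.map_comul, map_map, h3, h4, map_id_id]
  · obtain ⟨d, rfl⟩ := hb.2 c
    change Coring.counit (A := A) (e.symm (f d)) = Coring.counit (A := A) (f d)
    rw [h1, hf.map_counit]

end NCoring

theorem mainTheorem2 {A : Type u} [Ring A] {C : Type u} [AddCommGroup C] [Module A C]
    [Module Aᵐᵒᵖ C] [SMulCommClass A Aᵐᵒᵖ C] [NCoring.Coring A C]
    (habelian : Nonempty (CategoryTheory.Abelian (NCoring.RightComod A C)))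
    {ι : Type u} [DecidableEq ι] (P : ι → NCoring.RightComod A C)
    [∀ i, Module.Finite Aᵐᵒᵖ (P i)] [∀ i, Module.Projective Aᵐᵒᵖ (P i)]
    (hgen : (CategoryTheory.ObjectProperty.ofObj P).IsSeparating) :
    NCoring.IsCoringIso (NCoring.can (NCoring.RightComod.sum P)) :=
  (NCoring.isCoringHom_can P).isCoringIso (NCoring.can_bijective P habelian hgen)
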